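/- Let $d$ be a natural number, and let $W \in \mathbb{R}^{d\times d}$, $W_{\mathrm{in}} \in \mathbb{R}^{d\times 2}$, $b \in \mathbb{R}^d$, $w_{\mathrm{out}} \in \mathbb{R}^{1\times d}$ and $b_{\mathrm{out}} \in \mathbb{R}$ be arbitrary. Let $\sigma(z) = 1/(1+e^{-z})$ be the logistic sigmoid, and let $\tanh$ act coordinatewise on $\mathbb{R}^d$. Then for every stationary opponent action $a_{\mathrm{opp}}^{*} \in [0,1]$ the self-consistency equation $$x^{*} = \tanh\bigl(W x^{*} + W_{\mathrm{in}}\,[\sigma(w_{\mathrm{out}} \cdot x^{*} + b_{\mathrm{out}}),\ a_{\mathrm{opp}}^{*}]^{\top} + b\bigr)$$ has at least one solution $x^{*} \in [-1,1]^d$; that is, the closed-loop reservoir map $\Phi(x) = \tanh\bigl(Wx + W_{\mathrm{in}}[\sigma(w_{\mathrm{out}}\cdot x + b_{\mathrm{out}}), a_{\mathrm{opp}}^{*}]^{\top} + b\bigr)$ has a fixed point in the cube $[-1,1]^d$. -/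

import Mathlib

open scoped Matrix

namespace BodyReservoir

/-- The parameters of a body reservoir (an echo state network with `d` neurons)
together with its readout. -/
structure Reservoir (d : ℕ) where
  /-- recurrent weight matrix -/
  W : Matrix (Fin d) (Fin d) ℝ
  /-- input weight matrix; column `0` receives the own action, column `1` the opponent's -/
  Win : Matrix (Fin d) (Fin 2) ℝ
  /-- bias vector -/
  b : Fin d → ℝ
  /-- readout weight vector -/
  wout : Fin d → ℝ
  /-- readout bias -/
  bout : ℝ

namespace Reservoir

variable {d : ℕ}

/-- The readout action `σ(w_out · x + b_out)`, with `σ` the logistic sigmoid. -/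
noncomputable def readout (R : Reservoir d) (x : Fin d → ℝ) : ℝ :=
  Real.sigmoid (R.wout ⬝ᵥ x + R.bout)

/-- One noise-free step of the reservoir from the state `x`, for the own action `a` and the
opponent's action `aOpp`: `tanh (W x + W_in [a, aOpp]ᵀ + b)`, with `tanh` taken coordinatewise. -/
noncomputable def step (R : Reservoir d) (a aOpp : ℝ) (x : Fin d → ℝ) : Fin d → ℝ :=
  fun i => Real.tanh ((R.W *ᵥ x + R.Win *ᵥ ![a, aOpp] + R.b) i)

/-- The closed-loop map `Φ`: the readout is fed back as the agent's own action, and the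
opponent plays `aOpp`. -/
noncomputable def closedLoop (R : Reservoir d) (aOpp : ℝ) (x : Fin d → ℝ) : Fin d → ℝ :=
  R.step (R.readout x) aOpp x

/-- `x` is a self-consistent fixed point for the stationary opponent action `aOpp`:
`x = tanh (W x + W_in [σ(w_out · x + b_out), aOpp]ᵀ + b)`. -/
def IsSelfConsistent (R : Reservoir d) (aOpp : ℝ) (x : Fin d → ℝ) : Prop :=
  x = R.closedLoop aOpp x

end Reservoir

end BodyReservoir

open MeasureTheory Filter Topology

/-! The closed loop `Φ` is a bounded, Lipschitz, differentiable self-map of all of `ℝ^d`, and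
`|tanh| < 1` puts any fixed point in the cube. Existence is an analytic degree argument. Let `I(t) =
∫ exp(-lam |x - tΦ(x)|²) det(1 - t DΦ(x)) dx`. For small `t ≥ 0` the map `x ↦ x - tΦ(x)` is a
bijection with positive Jacobian, so `I(t) = (π/lam)^(d/2)` by change of variables. Gaussian
domination makes `I` entire in `t`, so this value persists at `t = 1` (`integral_gaussianPullback`).
Without a fixed point, `|x - Φ(x)|² ≥ c > 0`, and `I(1)` would decay exponentially in `lam`, whereas
`(π/lam)^(d/2)` decays only polynomially. -/

theorem differentiable_integral_of_locally_dominated {α : Type*} [MeasurableSpace α]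
    {μ : Measure α} {F : ℂ → α → ℂ}
    (hmeas : ∀ t, AEStronglyMeasurable (F t) μ) (hdiff : ∀ x, Differentiable ℂ fun t => F t x)
    (hbound : ∀ M : ℝ, ∃ G : α → ℝ, Integrable G μ ∧ ∀ t : ℂ, ‖t‖ ≤ M → ∀ x, ‖F t x‖ ≤ G x) :
    Differentiable ℂ fun t => ∫ x, F t x ∂μ := by
  intro t₀
  -- Radius 1 for the neighbourhood of `t₀`, and 1 more for the Cauchy estimate on unit circles
  -- centred in it; thus `G` also dominates the derivative.
  obtain ⟨G, hG, hFG⟩ := hbound (‖t₀‖ + 2)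
  have hderiv_meas : AEStronglyMeasurable (fun x => deriv (fun t => F t x) t₀) μ := by
    -- The derivative is measurable in `x` as a limit of difference quotients along `1/(n+1)`.
    have hu : Tendsto (fun n : ℕ => ((1 / ((n : ℝ) + 1) : ℝ) : ℂ)) atTop (𝓝[≠] 0) := by
      rw [tendsto_nhdsWithin_iff]
      refine ⟨?_, Eventually.of_forall fun n => ?_⟩
      · exact_mod_cast (Complex.continuous_ofReal.tendsto 0).comp
          tendsto_one_div_add_atTop_nhds_zero_nat
      · simp only [Set.mem_compl_iff, Set.mem_singleton_iff, Complex.ofReal_eq_zero]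
        positivity
    refine aestronglyMeasurable_of_tendsto_ae atTop
      (f := fun (n : ℕ) x => ((1 / ((n : ℝ) + 1) : ℝ) : ℂ)⁻¹ •
        (F (t₀ + ((1 / ((n : ℝ) + 1) : ℝ) : ℂ)) x - F t₀ x))
      (fun n => ((hmeas (t₀ + ((1 / ((n : ℝ) + 1) : ℝ) : ℂ))).sub (hmeas t₀)).const_smul
        ((1 / ((n : ℝ) + 1) : ℝ) : ℂ)⁻¹) (Eventually.of_forall fun x => ?_)
    exact (hasDerivAt_iff_tendsto_slope_zero.1 (hdiff x t₀).hasDerivAt).comp hu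
  refine (hasDerivAt_integral_of_dominated_loc_of_deriv_le (F := F)
    (F' := fun t x => deriv (fun t => F t x) t) (bound := G) (Metric.ball_mem_nhds t₀ one_pos)
    (Eventually.of_forall hmeas)
    (hG.mono' (hmeas t₀) (Eventually.of_forall (hFG t₀ (by linarith)))) hderiv_meas
    (Eventually.of_forall fun x t ht => ?_) hG
    (Eventually.of_forall fun x t _ => (hdiff x t).hasDerivAt)).2.differentiableAt
  have := Complex.norm_deriv_le_of_forall_mem_sphere_norm_le (c := t) (R := 1) (C := G x) one_pos
    (hdiff x).diffContOnCl (fun z hz => hFG z ?_ x)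
  · simpa using this
  · rw [mem_sphere_iff_norm] at hz
    rw [mem_ball_iff_norm] at ht
    have h1 : ‖z‖ ≤ ‖z - t‖ + ‖t‖ := by simpa using norm_add_le (z - t) t
    have h2 : ‖t‖ ≤ ‖t - t₀‖ + ‖t₀‖ := by simpa using norm_add_le (t - t₀) t₀
    linarith

/-- Solving `x - tΦ(x) = y` means finding the fixed point of the contraction `x ↦ y + tΦ(x)`. -/
theorem bijective_sub_smul {E : Type*} [NormedAddCommGroup E] [NormedSpace ℝ E] [CompleteSpace E]
    {Φ : E → E} {K : NNReal} (hK : LipschitzWith K Φ) {t : ℝ} (ht : 0 ≤ t) (htK : t * K < 1) :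
    Function.Bijective fun x => x - t • Φ x := by
  lift t to NNReal using ht
  have hcontr : ∀ y, ContractingWith (t * K) fun x => y + (t : ℝ) • Φ x := fun y =>
    ⟨by exact_mod_cast htK, LipschitzWith.of_dist_le_mul fun a b => by
      have := hK.dist_le_mul a b
      rw [dist_add_left, dist_smul₀, Real.norm_of_nonneg t.coe_nonneg, NNReal.coe_mul, mul_assoc]
      gcongr⟩
  refine ⟨fun a b hab => ?_, fun y => ⟨ContractingWith.fixedPoint _ (hcontr y), ?_⟩⟩
  · have h := hcontr (a - (t : ℝ) • Φ a)
    rw [h.fixedPoint_unique (x := a) (by simp [Function.IsFixedPt]),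
      h.fixedPoint_unique (x := b) (by
        have hab' : a - (t : ℝ) • Φ a = b - (t : ℝ) • Φ b := hab
        simp [Function.IsFixedPt, hab'])]
  · have h := (hcontr y).fixedPoint_isFixedPt
    exact sub_eq_iff_eq_add.2 h.symm

/-! ### Gaussian degree integral and fixed points of bounded Lipschitz maps -/

section GaussianDegree

variable {ι : Type*} [Fintype ι]

theorem norm_exp_neg_mul_sum_sq_le {lam : ℝ} (hlam : 0 < lam) {M C : ℝ} {t : ℂ} (ht : ‖t‖ ≤ M)
    (x y : ι → ℝ) (hy : ∀ i, |y i| ≤ C) :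
    ‖Complex.exp (-lam * ∑ i, ((x i : ℂ) - t * y i) ^ 2)‖ ≤
      Real.exp (lam * (Fintype.card ι * (M ^ 2 * C ^ 2))) *
        ∏ i, Real.exp (-(lam / 2) * x i ^ 2) := by
  rw [Complex.norm_exp, ← Real.exp_sum, ← Real.exp_add, Real.exp_le_exp]
  have key : ∀ i, x i ^ 2 / 2 - M ^ 2 * C ^ 2 ≤ (((x i : ℂ) - t * y i) ^ 2).re := by
    intro i
    have h1 : (((x i : ℂ) - t * y i) ^ 2).re = (x i - t.re * y i) ^ 2 - (t.im * y i) ^ 2 := by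
      simp [pow_two]
    have h2 : t.re ^ 2 + t.im ^ 2 ≤ M ^ 2 := by
      have : t.re ^ 2 + t.im ^ 2 = ‖t‖ ^ 2 := by
        rw [← Complex.normSq_eq_norm_sq, Complex.normSq_apply]; ring
      rw [this]
      exact pow_le_pow_left₀ (norm_nonneg _) ht 2
    have h3 : y i ^ 2 ≤ C ^ 2 := sq_le_sq' (abs_le.1 (hy i)).1 (abs_le.1 (hy i)).2
    have h4 : (t.re ^ 2 + t.im ^ 2) * y i ^ 2 ≤ M ^ 2 * C ^ 2 :=
      mul_le_mul h2 h3 (sq_nonneg _) (sq_nonneg _)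
    rw [h1]
    -- With `a = t.re`: `(x - ay)² - x²/2 + a²y² = (x - 2ay)²/2`.
    nlinarith [sq_nonneg (x i - 2 * (t.re * y i))]
  have hsum := Finset.sum_le_sum fun i (_ : i ∈ Finset.univ) => key i
  rw [Finset.sum_sub_distrib, Finset.sum_const, Finset.card_univ, nsmul_eq_mul,
    ← Finset.sum_div] at hsum
  rw [← Finset.mul_sum, ← Complex.ofReal_neg, Complex.re_ofReal_mul, Complex.re_sum]
  nlinarith

theorem integrable_prod_exp_neg_mul_sq {b : ℝ} (hb : 0 < b) :
    Integrable fun x : ι → ℝ => ∏ i, Real.exp (-b * x i ^ 2) :=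
  Integrable.fintype_prod fun _ => integrable_exp_neg_mul_sq hb

theorem integral_exp_neg_mul_sum_sq (lam : ℝ) :
    ∫ y : ι → ℝ, Real.exp (-lam * ∑ i, y i ^ 2) = √(Real.pi / lam) ^ Fintype.card ι := by
  simp_rw [Finset.mul_sum, Real.exp_sum]
  rw [integral_fintype_prod_volume_eq_prod fun (_ : ι) (y : ℝ) => Real.exp (-lam * y ^ 2)]
  simp_rw [integral_gaussian, Finset.prod_const, Finset.card_univ]

/-- On the ball of radius `|C| + 1` compactness gives a positive minimum; outside it some coordinate
moves by at least 1. -/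
theorem exists_pos_le_sum_sub_sq {Φ : (ι → ℝ) → ι → ℝ} (hΦ : Continuous Φ) {C : ℝ}
    (hC : ∀ x i, |Φ x i| ≤ C) (hfix : ∀ x, Φ x ≠ x) :
    ∃ c > 0, ∀ x, c ≤ ∑ i, (x i - Φ x i) ^ 2 := by
  have hpos : ∀ x, 0 < ∑ i, (x i - Φ x i) ^ 2 := by
    intro x
    obtain ⟨i, hi⟩ := Function.ne_iff.1 (hfix x)
    exact Finset.sum_pos' (fun _ _ => sq_nonneg _)
      ⟨i, Finset.mem_univ i, sq_pos_of_ne_zero (sub_ne_zero.2 hi.symm)⟩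
  obtain ⟨x₀, -, hx₀⟩ := (isCompact_closedBall (0 : ι → ℝ) (|C| + 1)).exists_isMinOn
    ⟨0, by simp; positivity⟩ (f := fun x => ∑ i, (x i - Φ x i) ^ 2)
    (Continuous.continuousOn (by fun_prop))
  refine ⟨min 1 (∑ i, (x₀ i - Φ x₀ i) ^ 2), lt_min one_pos (hpos x₀), fun x => ?_⟩
  by_cases hx : x ∈ Metric.closedBall (0 : ι → ℝ) (|C| + 1)
  · exact (min_le_right _ _).trans (hx₀ hx)
  · refine (min_le_left _ _).trans ?_
    rw [mem_closedBall_zero_iff, pi_norm_le_iff_of_nonneg (by positivity)] at hx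
    push Not at hx
    obtain ⟨i, hi⟩ := hx
    refine le_trans ?_ (Finset.single_le_sum (f := fun i => (x i - Φ x i) ^ 2)
      (fun _ _ => sq_nonneg _) (Finset.mem_univ i))
    have h1 : 1 ≤ |x i - Φ x i| := by
      have := abs_sub_abs_le_abs_sub (x i) (Φ x i)
      have h2 := (hC x i).trans (le_abs_self C)
      rw [Real.norm_eq_abs] at hi
      linarith
    have := one_le_pow₀ h1 (n := 2)
    rwa [sq_abs] at this

variable [DecidableEq ι]

/-- The Jacobian matrix of a self-map of `ι → ℝ`. -/
noncomputable def jacobianMatrix (Φ : (ι → ℝ) → ι → ℝ) (x : ι → ℝ) : Matrix ι ι ℝ :=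
  LinearMap.toMatrix' (fderiv ℝ Φ x : (ι → ℝ) →ₗ[ℝ] ι → ℝ)

/-- The pull-back along `x ↦ x - t Φ(x)` of the Gaussian density `exp (-lam |y|²)`,
continued to complex `t`. -/
noncomputable def gaussianPullback (lam : ℝ) (Φ : (ι → ℝ) → ι → ℝ) (t : ℂ) (x : ι → ℝ) : ℂ :=
  Complex.exp (-lam * ∑ i, ((x i : ℂ) - t * Φ x i) ^ 2) *
    (1 - t • (jacobianMatrix Φ x).map ((↑) : ℝ → ℂ)).det

theorem jacobianMatrix_apply (Φ : (ι → ℝ) → ι → ℝ) (x : ι → ℝ) (i j : ι) :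
    jacobianMatrix Φ x i j = fderiv ℝ Φ x (Pi.single j 1) i := by
  simp [jacobianMatrix, LinearMap.toMatrix'_apply]

theorem measurable_jacobianMatrix_apply (Φ : (ι → ℝ) → ι → ℝ) (i j : ι) :
    Measurable fun x => jacobianMatrix Φ x i j := by
  simp only [jacobianMatrix_apply]
  exact (measurable_pi_apply i).comp (measurable_fderiv_apply_const ℝ Φ _)

theorem norm_jacobianMatrix_apply_le {Φ : (ι → ℝ) → ι → ℝ} {K : NNReal} (hK : LipschitzWith K Φ)
    (x : ι → ℝ) (i j : ι) : |jacobianMatrix Φ x i j| ≤ K := by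
  rw [jacobianMatrix_apply, ← Real.norm_eq_abs]
  calc _ ≤ ‖fderiv ℝ Φ x (Pi.single j 1)‖ := norm_le_pi_norm _ i
    _ ≤ ‖fderiv ℝ Φ x‖ * ‖(Pi.single j 1 : ι → ℝ)‖ := ContinuousLinearMap.le_opNorm _ _
    _ ≤ K * 1 := mul_le_mul (norm_fderiv_le_of_lipschitz ℝ hK)
      ((pi_norm_le_iff_of_nonneg zero_le_one).2 fun k => by
        rw [Pi.single_apply]; split_ifs <;> simp) (norm_nonneg _) K.2
    _ = K := mul_one _

theorem measurable_gaussianPullback (lam : ℝ) {Φ : (ι → ℝ) → ι → ℝ} (hΦ : Continuous Φ) (t : ℂ) :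
    Measurable (gaussianPullback lam Φ t) := by
  unfold gaussianPullback
  refine Measurable.mul (Continuous.measurable (by fun_prop)) ?_
  have hentry : ∀ i j, Measurable fun x =>
      (1 - t • (jacobianMatrix Φ x).map ((↑) : ℝ → ℂ)) i j := fun i j =>
    measurable_const.sub
      ((Complex.measurable_ofReal.comp (measurable_jacobianMatrix_apply Φ i j)).const_smul t)
  simp_rw [Matrix.det_apply]
  exact Finset.measurable_sum _ fun σ _ => Measurable.const_smul
    (Finset.measurable_prod _ fun i _ => hentry _ _) _

theorem differentiable_gaussianPullback (lam : ℝ) (Φ : (ι → ℝ) → ι → ℝ) (x : ι → ℝ) :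
    Differentiable ℂ fun t => gaussianPullback lam Φ t x := by
  unfold gaussianPullback
  refine Differentiable.mul (by fun_prop) ?_
  simp only [Matrix.det_apply, Matrix.sub_apply, Matrix.smul_apply, Matrix.map_apply]
  fun_prop

theorem norm_det_one_sub_smul_jacobianMatrix_le {Φ : (ι → ℝ) → ι → ℝ} {K : NNReal}
    (hK : LipschitzWith K Φ) {M : ℝ} {t : ℂ} (ht : ‖t‖ ≤ M) (x : ι → ℝ) :
    ‖(1 - t • (jacobianMatrix Φ x).map ((↑) : ℝ → ℂ)).det‖ ≤
      (Fintype.card ι).factorial * (1 + M * K) ^ Fintype.card ι := by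
  have := Matrix.det_le (A := 1 - t • (jacobianMatrix Φ x).map ((↑) : ℝ → ℂ))
    (abv := (NormedField.toAbsoluteValue ℂ)) (x := 1 + M * K) (fun i j => ?_)
  · rwa [nsmul_eq_mul] at this
  · change ‖(1 : Matrix ι ι ℂ) i j - t * (jacobianMatrix Φ x i j : ℂ)‖ ≤ _
    refine (norm_sub_le _ _).trans (add_le_add ?_ ?_)
    · rw [Matrix.one_apply]; split_ifs <;> simp
    · rw [norm_mul, Complex.norm_real]
      exact mul_le_mul ht (norm_jacobianMatrix_apply_le hK x i j) (norm_nonneg _)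
        ((norm_nonneg t).trans ht)

theorem gaussianPullback_dominated {lam : ℝ} (hlam : 0 < lam) {Φ : (ι → ℝ) → ι → ℝ} {K : NNReal}
    (hK : LipschitzWith K Φ) {C : ℝ} (hC : ∀ x i, |Φ x i| ≤ C) (M : ℝ) :
    ∃ G : (ι → ℝ) → ℝ, Integrable G ∧
      ∀ t : ℂ, ‖t‖ ≤ M → ∀ x, ‖gaussianPullback lam Φ t x‖ ≤ G x := by
  refine ⟨_, ((integrable_prod_exp_neg_mul_sq (ι := ι) (half_pos hlam)).const_mul
    (Real.exp (lam * (Fintype.card ι * (M ^ 2 * C ^ 2))))).mul_const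
      ((Fintype.card ι).factorial * (1 + M * K) ^ Fintype.card ι), fun t ht x => ?_⟩
  rw [gaussianPullback, norm_mul]
  exact mul_le_mul (norm_exp_neg_mul_sum_sq_le hlam ht x (Φ x) (hC x))
    (norm_det_one_sub_smul_jacobianMatrix_le hK ht x) (norm_nonneg _) (by positivity)

theorem differentiable_integral_gaussianPullback {lam : ℝ} (hlam : 0 < lam)
    {Φ : (ι → ℝ) → ι → ℝ} {K : NNReal} (hK : LipschitzWith K Φ) {C : ℝ}
    (hC : ∀ x i, |Φ x i| ≤ C) :
    Differentiable ℂ fun t => ∫ x, gaussianPullback lam Φ t x :=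
  differentiable_integral_of_locally_dominated
    (fun t => (measurable_gaussianPullback lam hK.continuous t).aestronglyMeasurable)
    (differentiable_gaussianPullback lam Φ) (gaussianPullback_dominated hlam hK hC)

theorem gaussianPullback_ofReal (lam : ℝ) (Φ : (ι → ℝ) → ι → ℝ) (t : ℝ) (x : ι → ℝ) :
    gaussianPullback lam Φ t x =
      ((Real.exp (-lam * ∑ i, (x i - t * Φ x i) ^ 2) * (1 - t • jacobianMatrix Φ x).det : ℝ) : ℂ) := by
  have hmat : (1 : Matrix ι ι ℂ) - (t : ℂ) • (jacobianMatrix Φ x).map ((↑) : ℝ → ℂ) =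
      Complex.ofRealHom.mapMatrix (1 - t • jacobianMatrix Φ x) := by
    ext i j
    by_cases h : i = j <;> simp [h]
  rw [gaussianPullback, hmat, ← RingHom.map_det]
  push_cast
  rfl

/-- For `s ≤ t` the operator `s DΦ(x)` has norm below 1, so the determinant cannot vanish on `[0,
t]`, and it equals 1 at `s = 0`. -/
theorem det_one_sub_smul_jacobianMatrix_pos {Φ : (ι → ℝ) → ι → ℝ} {K : NNReal}
    (hK : LipschitzWith K Φ) {t : ℝ} (ht : 0 ≤ t) (htK : t * K < 1) (x : ι → ℝ) :
    0 < (1 - t • jacobianMatrix Φ x).det := by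
  have hne : ∀ s ∈ Set.Icc 0 t, (1 - s • jacobianMatrix Φ x).det ≠ 0 := by
    intro s hs h0
    obtain ⟨v, hv, hv0⟩ := Matrix.exists_mulVec_eq_zero_iff.2 h0
    have hv1 : v = s • fderiv ℝ Φ x v := by
      have : (jacobianMatrix Φ x).mulVec v = fderiv ℝ Φ x v := by
        rw [jacobianMatrix, LinearMap.toMatrix'_mulVec]; rfl
      rw [Matrix.sub_mulVec, Matrix.one_mulVec, Matrix.smul_mulVec, this] at hv0
      exact sub_eq_zero.1 hv0
    have h1 : ‖v‖ ≤ t * K * ‖v‖ := by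
      calc ‖v‖ = ‖s • fderiv ℝ Φ x v‖ := congrArg _ hv1
        _ = s * ‖fderiv ℝ Φ x v‖ := by rw [norm_smul, Real.norm_of_nonneg hs.1]
        _ ≤ t * (K * ‖v‖) := mul_le_mul hs.2
            ((fderiv ℝ Φ x).le_of_opNorm_le (norm_fderiv_le_of_lipschitz ℝ hK) v)
            (norm_nonneg _) ht
        _ = _ := by ring
    have h2 := norm_pos_iff.2 hv
    nlinarith
  by_contra hneg
  have hcont : ContinuousOn (fun s : ℝ => (1 - s • jacobianMatrix Φ x).det) (Set.Icc 0 t) :=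
    Continuous.continuousOn (by fun_prop)
  obtain ⟨s, hs, h0⟩ := intermediate_value_Icc' ht hcont
    (show (0 : ℝ) ∈ Set.Icc _ _ from ⟨not_lt.1 hneg, by simp⟩)
  exact hne s hs h0

theorem integral_gaussianPullback_of_mul_lt_one (lam : ℝ) {Φ : (ι → ℝ) → ι → ℝ} {K : NNReal}
    (hK : LipschitzWith K Φ) (hΦ : Differentiable ℝ Φ) {t : ℝ} (ht : 0 ≤ t) (htK : t * K < 1) :
    ∫ x, gaussianPullback lam Φ t x = (√(Real.pi / lam) ^ Fintype.card ι : ℝ) := by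
  simp_rw [gaussianPullback_ofReal]
  rw [integral_complex_ofReal, Complex.ofReal_inj, ← integral_exp_neg_mul_sum_sq]
  have hbij := bijective_sub_smul hK ht htK
  have hcv := integral_image_eq_integral_abs_det_fderiv_smul volume MeasurableSet.univ
    (f := fun x => x - t • Φ x) (f' := fun x => ContinuousLinearMap.id ℝ _ - t • fderiv ℝ Φ x)
    (fun x _ => ((hasFDerivAt_id x).sub ((hΦ x).hasFDerivAt.const_smul t)).hasFDerivWithinAt)
    hbij.injective.injOn (fun y => Real.exp (-lam * ∑ i, y i ^ 2))
  rw [Set.image_univ, hbij.surjective.range_eq, setIntegral_univ, setIntegral_univ] at hcv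
  rw [hcv]
  refine integral_congr_ae (Eventually.of_forall fun x => ?_)
  have hdet : (ContinuousLinearMap.id ℝ (ι → ℝ) - t • fderiv ℝ Φ x).det =
      (1 - t • jacobianMatrix Φ x).det := by
    rw [ContinuousLinearMap.det, ← LinearMap.det_toMatrix', jacobianMatrix]
    congr 1
    rw [← map_smul, ← LinearMap.toMatrix'_one, ← map_sub]
    rfl
  simp only [hdet, abs_of_pos (det_one_sub_smul_jacobianMatrix_pos hK ht htK x), smul_eq_mul,
    Pi.sub_apply, Pi.smul_apply]
  ring

/-- Identity theorem: the entire function agrees with a constant at small positive reals, which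
accumulate at 0. -/
theorem integral_gaussianPullback {lam : ℝ} (hlam : 0 < lam) {Φ : (ι → ℝ) → ι → ℝ} {K : NNReal}
    (hK : LipschitzWith K Φ) (hΦ : Differentiable ℝ Φ) {C : ℝ} (hC : ∀ x i, |Φ x i| ≤ C) (t : ℂ) :
    ∫ x, gaussianPullback lam Φ t x = (√(Real.pi / lam) ^ Fintype.card ι : ℝ) := by
  have hA : AnalyticOnNhd ℂ (fun t => ∫ x, gaussianPullback lam Φ t x) Set.univ :=
    fun z _ => (differentiable_integral_gaussianPullback hlam hK hC).analyticAt z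
  refine hA.eqOn_of_preconnected_of_frequently_eq analyticOnNhd_const
    isPreconnected_univ (Set.mem_univ 0) ?_ (Set.mem_univ t)
  have hu : Tendsto (fun s : ℝ => (s : ℂ)) (𝓝[>] 0) (𝓝[≠] 0) := by
    rw [tendsto_nhdsWithin_iff]
    refine ⟨(Complex.continuous_ofReal.tendsto 0).mono_left nhdsWithin_le_nhds, ?_⟩
    filter_upwards [self_mem_nhdsWithin] with s hs
    simpa using (ne_of_gt hs)
  refine hu.frequently (Eventually.frequently ?_)
  have hsmall : ∀ᶠ s : ℝ in 𝓝[>] 0, s * K < 1 := by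
    refine nhdsWithin_le_nhds (Tendsto.eventually_lt_const (u := 1) (v := 0) one_pos ?_)
    exact Continuous.tendsto' (by fun_prop) _ _ (by simp)
  filter_upwards [hsmall, self_mem_nhdsWithin] with s hs hs0
  exact integral_gaussianPullback_of_mul_lt_one lam hK hΦ (le_of_lt hs0) hs

theorem exists_fixedPoint_of_bounded_lipschitz_differentiable {Φ : (ι → ℝ) → ι → ℝ} {K : NNReal}
    (hK : LipschitzWith K Φ) (hΦ : Differentiable ℝ Φ) {C : ℝ} (hC : ∀ x i, |Φ x i| ≤ C) :
    ∃ x, Φ x = x := by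
  by_contra hfix
  push Not at hfix
  obtain ⟨c, hc, hcle⟩ := exists_pos_le_sum_sub_sq hK.continuous hC hfix
  obtain ⟨G, hG, hGle⟩ := gaussianPullback_dominated one_pos hK hC 1
  -- Splitting `exp(-lam S) = exp(-(lam-1)S) exp(-S)` with `S ≥ c` lets one `G`, taken at `lam = 1`,
  -- serve every `lam`.
  have hle : ∀ lam : ℝ, 1 ≤ lam →
      √(Real.pi / lam) ^ Fintype.card ι ≤ Real.exp (-(lam - 1) * c) * ∫ x, G x := by
    intro lam hlam
    have h := integral_gaussianPullback (one_pos.trans_le hlam) hK hΦ hC 1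
    have h' := norm_integral_le_of_norm_le (hG.const_mul (Real.exp (-(lam - 1) * c)))
      (f := gaussianPullback lam Φ 1) (Eventually.of_forall fun x => ?_)
    · rw [h, Complex.norm_real, Real.norm_of_nonneg (by positivity),
        integral_const_mul] at h'
      exact h'
    · refine le_trans ?_ (mul_le_mul_of_nonneg_left (hGle 1 (by simp) x) (Real.exp_pos _).le)
      have hsplit (l : ℝ) := gaussianPullback_ofReal l Φ 1 x
      simp only [Complex.ofReal_one, one_mul] at hsplit
      rw [hsplit, hsplit, Complex.norm_real, Complex.norm_real, norm_mul, norm_mul, ← mul_assoc,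
        Real.norm_of_nonneg (Real.exp_pos _).le, Real.norm_of_nonneg (Real.exp_pos _).le,
        ← Real.exp_add]
      gcongr
      nlinarith [hcle x]
  have hlim : Tendsto (fun s : ℝ => s ^ Fintype.card ι * Real.exp (-(s * c)) *
      (Real.exp c * ∫ x, G x)) atTop (𝓝 0) := by
    have h1 := ((Real.tendsto_pow_mul_exp_neg_atTop_nhds_zero (Fintype.card ι)).comp
      (tendsto_id.atTop_mul_const hc)).mul_const ((c ^ Fintype.card ι)⁻¹ * (Real.exp c * ∫ x, G x))
    rw [zero_mul] at h1
    refine h1.congr fun s => ?_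
    simp only [Function.comp_apply, id_eq, mul_pow]
    field_simp
  have hπ : 0 < √Real.pi ^ Fintype.card ι := by positivity
  obtain ⟨s, hs, hs1⟩ := ((hlim.eventually_lt_const hπ).and (eventually_ge_atTop 1)).exists
  refine hs.not_ge ?_
  have hs0 : 0 < s := one_pos.trans_le hs1
  have hGnn : 0 ≤ ∫ x, G x :=
    integral_nonneg fun x => (norm_nonneg _).trans (hGle 0 (by simp) x)
  -- `lam = s²` clears the square root; below, `s² ≥ s` reduces the exponent to a linear one.
  have h := hle (s ^ 2) (one_le_pow₀ hs1)
  rw [Real.sqrt_div Real.pi_pos.le, Real.sqrt_sq hs0.le, div_pow,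
    div_le_iff₀ (by positivity)] at h
  refine h.trans ?_
  have hexp : Real.exp (-(s ^ 2 - 1) * c) ≤ Real.exp (-(s * c)) * Real.exp c := by
    rw [← Real.exp_add]
    gcongr
    nlinarith [mul_nonneg (mul_nonneg hs0.le (sub_nonneg.2 hs1)) hc.le]
  calc _ ≤ Real.exp (-(s * c)) * Real.exp c * (∫ x, G x) * s ^ Fintype.card ι := by gcongr
    _ = _ := by ring

end GaussianDegree

/-! ### Regularity of the activations and of the closed loop -/

theorem Real.hasDerivAt_tanh (x : ℝ) : HasDerivAt Real.tanh (1 / Real.cosh x ^ 2) x := by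
  have h := (Real.hasDerivAt_sinh x).div (Real.hasDerivAt_cosh x) (Real.cosh_pos x).ne'
  rw [← sq, ← sq, Real.cosh_sq_sub_sinh_sq] at h
  exact h.congr_of_eventuallyEq (Eventually.of_forall Real.tanh_eq_sinh_div_cosh)

theorem Real.lipschitzWith_tanh : LipschitzWith 1 Real.tanh := by
  refine lipschitzWith_of_nnnorm_deriv_le (fun x => (Real.hasDerivAt_tanh x).differentiableAt)
    fun x => ?_
  rw [(Real.hasDerivAt_tanh x).deriv, ← NNReal.coe_le_coe, coe_nnnorm,
    Real.norm_of_nonneg (by positivity), NNReal.coe_one]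
  exact div_le_one_of_le₀ (one_le_pow₀ (Real.one_le_cosh x)) (by positivity)

theorem Real.lipschitzWith_sigmoid : LipschitzWith 1 Real.sigmoid := by
  refine lipschitzWith_of_nnnorm_deriv_le differentiable_sigmoid fun x => ?_
  rw [Real.deriv_sigmoid, ← NNReal.coe_le_coe, coe_nnnorm, NNReal.coe_one, Real.norm_eq_abs,
    abs_le]
  constructor <;> nlinarith [Real.sigmoid_pos x, Real.sigmoid_lt_one x]

theorem exists_lipschitzWith_pi {E ι : Type*} [PseudoMetricSpace E] [Fintype ι] {f : E → ι → ℝ}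
    (h : ∀ i, ∃ K, LipschitzWith K fun x => f x i) : ∃ K, LipschitzWith K f := by
  choose K hK using h
  refine ⟨∑ i, K i, LipschitzWith.of_dist_le_mul fun x y =>
    (dist_pi_le_iff (by positivity)).2 fun i => ((hK i).dist_le_mul x y).trans ?_⟩
  gcongr
  exact Finset.single_le_sum (f := K) (fun _ _ => zero_le) (Finset.mem_univ i)

namespace BodyReservoir.Reservoir

variable {d : ℕ} (R : Reservoir d) (aOpp : ℝ)

/-- In this form each coordinate is built from continuous linear maps, `tanh` and `sigmoid`, so
differentiability and Lipschitz bounds follow by composition. -/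
theorem closedLoop_apply (x : Fin d → ℝ) (i : Fin d) :
    R.closedLoop aOpp x i = Real.tanh (LinearMap.toContinuousLinearMap
      (LinearMap.proj i ∘ₗ Matrix.toLin' R.W) x +
      R.Win i 0 • Real.sigmoid (LinearMap.toContinuousLinearMap
        (dotProductBilin ℝ ℝ R.wout) x + R.bout) + (R.Win i 1 * aOpp + R.b i)) := by
  simp [closedLoop, step, readout, Matrix.mulVec, dotProduct, Fin.sum_univ_two, add_assoc]

theorem differentiable_closedLoop : Differentiable ℝ (R.closedLoop aOpp) := by
  refine differentiable_pi.2 fun i => ?_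
  simp_rw [closedLoop_apply]
  have htanh : Differentiable ℝ Real.tanh := fun x => (Real.hasDerivAt_tanh x).differentiableAt
  have hsigmoid := differentiable_sigmoid.comp
    ((LinearMap.toContinuousLinearMap (dotProductBilin ℝ ℝ R.wout)).differentiable.add_const R.bout)
  exact htanh.comp (((ContinuousLinearMap.differentiable _).add
    (hsigmoid.const_smul (R.Win i 0))).add_const _)

theorem exists_lipschitzWith_closedLoop : ∃ K, LipschitzWith K (R.closedLoop aOpp) := by
  refine exists_lipschitzWith_pi fun i => ?_
  simp_rw [closedLoop_apply]
  exact ⟨_, Real.lipschitzWith_tanh.comp (((ContinuousLinearMap.lipschitz _).add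
    ((lipschitzWith_smul (R.Win i 0)).comp (Real.lipschitzWith_sigmoid.comp
      ((ContinuousLinearMap.lipschitz _).add (LipschitzWith.const _))))).add
        (LipschitzWith.const _))⟩

end BodyReservoir.Reservoir

theorem theorem1 (d : ℕ) (R : BodyReservoir.Reservoir d) (aOpp : ℝ)
    (haOpp : aOpp ∈ Set.Icc (0 : ℝ) 1) :
    ∃ x : Fin d → ℝ, (∀ i, x i ∈ Set.Icc (-1 : ℝ) 1) ∧ R.IsSelfConsistent aOpp x := by
  obtain ⟨K, hK⟩ := R.exists_lipschitzWith_closedLoop aOpp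
  have hbound : ∀ x i, |R.closedLoop aOpp x i| ≤ 1 := fun x i => (Real.abs_tanh_lt_one _).le
  obtain ⟨x, hx⟩ := exists_fixedPoint_of_bounded_lipschitz_differentiable hK
    (R.differentiable_closedLoop aOpp) hbound
  refine ⟨x, fun i => ?_, hx.symm⟩
  rw [← hx]
  exact abs_le.1 (hbound x i)
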